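/- Let $M$ be a simple matroid of rank at most three on $[d]=\{1,\dots,d\}$. A \emph{line} of $M$ is a maximal dependent subset of $[d]$ all of whose three-element subsets are dependent; $\mathcal L_M$ is the set of lines, and $\mathcal L_p$ the set of lines containing the point $p$. Two kinds of building blocks are used. A \emph{line matroid} is a uniform matroid $U_{2,m}$, $m\ge 1$ (its independent sets are the subsets with at most two elements). A \emph{cycle} is a simple matroid of rank at most three with exactly $n\ge 3$ lines $l_1,\dots,l_n$ and with distinct points $p_1,\dots,p_n$ such that $\mathcal L_{p_i}=\{l_i,l_{i+1}\}$ for all $i$ (where $l_{n+1}=l_1$), while every other point lies on exactly one line. The \emph{free gluing} of $N$ and $N'$ at points $p$ of $N$ and $q$ of $N'$ is the simple matroid of rank at most three whose ground set is the disjoint union of the two ground sets with $p$ and $q$ identified, and whose lines are the (images of the) lines of $N$ and of $N'$. A \emph{connected cactus configuration} is a matroid obtained from a line matroid or a cycle by finitely many (possibly zero) successive free gluings with line matroids or cycles. A \emph{cactus configuration} is a simple matroid $M$ of rank at most three such that the restriction of $M$ to each of its connected components is a connected cactus configuration; here the connected components are the classes of points under the equivalence relation generated by lying on a common line. A \emph{realization}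 of $M$ is a family $\gamma=(\gamma_1,\dots,\gamma_d)$ of vectors of $\mathbb C^3$ such that a subset $S\subseteq[d]$ is dependent in $M$ if and only if the family $(\gamma_i)_{i\in S}$ is linearly dependent. Let $\Gamma_M\subseteq\mathbb C^{3d}$ be the set of realizations of $M$, and let the matroid variety $V_M$ be its Zariski closure in $\mathbb C^{3d}$. **Theorem.** Every cactus configuration $M$ is realizable, i.e. $\Gamma_M\neq\emptyset$, and its matroid variety $V_M$ is irreducible in the Zariski topology. -/

import Mathlib

open Set

namespace PointLine

variable {α : Type*}

/-! ### Simple matroids of rank at most three and their lines -/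

/-- A matroid is simple if it has no loops and no parallel elements, that is, if any two (possibly
equal) elements of the ground set form an independent set. -/
def IsSimple (M : Matroid α) : Prop :=
  ∀ x ∈ M.E, ∀ y ∈ M.E, M.Indep {x, y}

/-- A point-line configuration: a simple matroid of rank at most three on a finite ground set. -/
structure IsConfiguration (M : Matroid α) : Prop where
  finite : M.E.Finite
  simple : IsSimple M
  rank_le : M.eRank ≤ 3

/-- `L` is dependent and each of its three-element subsets is dependent. -/
def IsCollinear (M : Matroid α) (L : Set α) : Prop :=
  M.Dep L ∧ ∀ T ⊆ L, T.encard = 3 → M.Dep T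

/-- The lines of `M`: the maximal dependent subsets of the ground set all of whose three-element
subsets are dependent. -/
def lines (M : Matroid α) : Set (Set α) :=
  {L | Maximal (IsCollinear M) L}

/-- The lines of `M` that contain the point `p`. -/
def linesThrough (M : Matroid α) (p : α) : Set (Set α) :=
  {L | L ∈ lines M ∧ p ∈ L}

/-! ### Lines and cycles, the building blocks of a cactus -/

/-- `M` is the uniform matroid `U_{2,d}` on its nonempty finite ground set of `d` elements: the
independent sets are the subsets with at most two elements. (For `d ≤ 2` there is no line in the
sense of `lines`, and the matroid consists of one or two free points.) -/
def IsUniformLine (M : Matroid α) : Prop :=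
  M.E.Finite ∧ M.E.Nonempty ∧ ∀ S ⊆ M.E, (M.Indep S ↔ S.encard ≤ 2)

/-- `M` is a cycle: it has `n ≥ 3` lines `l i`, cyclically ordered, and `n` distinct points `p i`
such that exactly `l i` and `l (i + 1)` pass through `p i`, while every other point lies on exactly
one line. -/
def IsCycle (M : Matroid α) : Prop :=
  IsConfiguration M ∧
    ∃ n : ℕ, 3 ≤ n ∧ ∃ (p : ZMod n → α) (l : ZMod n → Set α),
      Function.Injective p ∧ Function.Injective l ∧ range l = lines M ∧
      (∀ i, p i ∈ M.E ∧ linesThrough M (p i) = {l i, l (i + 1)}) ∧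
      ∀ x ∈ M.E, x ∉ range p → (linesThrough M x).encard = 1

/-! ### Free gluing and cactus configurations -/

/-- `M` is the free gluing of `M₁` and `M₂`, where the points of gluing of `M₁` and of `M₂` have
been identified to the point `P`: the ground sets of `M₁` and `M₂` share precisely `P`, and `M` is
the simple matroid of rank at most three on the union of the ground sets whose lines are those of
`M₁` and those of `M₂`. -/
structure IsFreeGluing (P : α) (M₁ M₂ M : Matroid α) : Prop where
  inter_eq : M₁.E ∩ M₂.E = {P}
  configuration : IsConfiguration M
  ground_eq : M.E = M₁.E ∪ M₂.E
  lines_eq : lines M = lines M₁ ∪ lines M₂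

/-- Connected cactus configurations: those obtained from a line or a cycle by successively freely
gluing lines or cycles. -/
inductive IsConnectedCactus : Matroid α → Prop
  | line {M : Matroid α} : IsUniformLine M → IsConnectedCactus M
  | cycle {M : Matroid α} : IsCycle M → IsConnectedCactus M
  | glue {P : α} {N N' M : Matroid α} : IsConnectedCactus N → (IsUniformLine N' ∨ IsCycle N') →
      IsFreeGluing P N N' M → IsConnectedCactus M

/-- The points of the connected component of `x`: those which can be reached from `x` by a finite
chain of points, any two consecutive ones of which lie on a common line. -/
def component (M : Matroid α) (x : α) : Set α :=
  {y | y ∈ M.E ∧ Relation.ReflTransGen (fun a b ↦ ∃ L ∈ lines M, a ∈ L ∧ b ∈ L) x y}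

/-- A cactus configuration: a simple matroid of rank at most three, each connected component of
which is a connected cactus configuration. -/
def IsCactus (M : Matroid α) : Prop :=
  IsConfiguration M ∧ ∀ x ∈ M.E, IsConnectedCactus (M.restrict (component M x))

/-! ### The Zariski topology and matroid varieties -/

/-- The Zariski topology on the affine space `ℂ^σ`: the closed sets are the zero loci of ideals of
the polynomial ring. -/
abbrev zariskiTopology (σ : Type*) : TopologicalSpace (σ → ℂ) :=
  TopologicalSpace.ofClosed
    {Z | ∃ I : Ideal (MvPolynomial σ ℂ), Z = MvPolynomial.zeroLocus ℂ I}
    ⟨⊤, by simp⟩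
    (by
      intro A hA
      refine ⟨MvPolynomial.vanishingIdeal ℂ (⋂₀ A), Subset.antisymm ?_ ?_⟩
      · exact MvPolynomial.zeroLocus_vanishingIdeal_le _
      · intro x hx Z hZ
        obtain ⟨I, rfl⟩ := hA hZ
        intro p hp
        exact hx p (MvPolynomial.mem_vanishingIdeal_iff.2 fun y hy ↦
          MvPolynomial.mem_zeroLocus_iff.1 (hy _ hZ) p hp))
    (by
      rintro _ ⟨I, rfl⟩ _ ⟨J, rfl⟩
      refine ⟨I * J, Subset.antisymm ?_ ?_⟩
      · rintro x (hx | hx) p hp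
        · exact hx p (Ideal.mul_le_left (I := I) (J := J) hp)
        · exact hx p (Ideal.mul_le_right (I := I) (J := J) hp)
      · intro x hx
        by_contra h
        simp only [mem_union, MvPolynomial.mem_zeroLocus_iff, not_or, not_forall] at h
        obtain ⟨⟨p, hp, hpx⟩, q, hq, hqx⟩ := h
        have := hx (p * q) (Ideal.mul_mem_mul hp hq)
        rw [map_mul] at this
        exact (mul_ne_zero hpx hqx) this)

/-- The realization space `Γ_M` of a matroid `M` on `[d]`, inside `ℂ^{3d}`: the collections of
vectors `γ₁, …, γ_d` in `ℂ³` (the vector `γ_i` has the coordinates `γ (i, 0), γ (i, 1), γ (i, 2)`)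
such that a set of points is dependent in `M` if and only if the family of the corresponding vectors
is linearly dependent. -/
def realizationSpace {d : ℕ} (M : Matroid (Fin d)) : Set (Fin d × Fin 3 → ℂ) :=
  {γ | ∀ S ⊆ M.E, (M.Dep S ↔ ¬ LinearIndepOn ℂ (fun (i : Fin d) (j : Fin 3) ↦ γ (i, j)) S)}

/-- The matroid variety `V_M`: the Zariski closure of the realization space in `ℂ^{3d}`. -/
def matroidVariety {d : ℕ} (M : Matroid (Fin d)) : Set (Fin d × Fin 3 → ℂ) :=
  @closure _ (zariskiTopology (Fin d × Fin 3)) (realizationSpace M)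

end PointLine

/-! A cactus can be built by adding its points one at a time so that each new point lies on at most
one line having three points among those present. Such an order exists because every nonempty set
`X` of points has a point lying on at most one line that meets `X` in three points
(`IsCactus.sparseOn`). For gluings, a block needs a stronger form in which this point avoids the
gluing point (`RootedSparseOn`).

Realizations are extended along this order. The vectors outside `X` are left free in
`partialRealizations M X`, so the vector of the next point `x` is available as a parameter. If `x`
is on no line of the new set, it keeps this vector; if it is on the line through `a` and `b`, its
vector becomes a combination of those of `a` and `b`, with two of the free coordinates as
coefficients. The realizations of `insert x X` are thus a polynomial image of those of `X`, cut by
finitely many open conditions (independent sets stay independent), each of which meets the image.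
This preserves irreducibility, including nonemptiness (`IsPolyIrreducible.image_inter`). The
induction starts from the whole affine space, and realizability comes out together with
irreducibility. -/

namespace PointLine

/-! ### Every set of points of a cactus has a point on at most one of its lines -/

section Sparse

variable {α : Type*}

/-- At most one of the lines in `𝓛` through `x` contains three points of `X`. -/
def AtMostOneLine (𝓛 : Set (Set α)) (X : Set α) (x : α) : Prop :=
  ∀ L ∈ 𝓛, ∀ K ∈ 𝓛, x ∈ L → x ∈ K → 3 ≤ (L ∩ X).encard → 3 ≤ (K ∩ X).encard → L = K

/-- Every nonempty subset `X` of `E` has a point through which there is at most one line of `X`. -/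
def SparseOn (𝓛 : Set (Set α)) (E : Set α) : Prop :=
  ∀ X ⊆ E, X.Nonempty → ∃ x ∈ X, AtMostOneLine 𝓛 X x

/-- The variant of `SparseOn` in which the point has to be different from a given root `P`. -/
def RootedSparseOn (𝓛 : Set (Set α)) (E : Set α) (P : α) : Prop :=
  ∀ X ⊆ E, ¬ X ⊆ {P} → ∃ x ∈ X, x ≠ P ∧ AtMostOneLine 𝓛 X x

theorem not_three_le_encard_of_subset_pair {S : Set α} {a b : α} (h : S ⊆ {a, b}) :
    ¬ 3 ≤ S.encard := by
  intro h3
  have h2 : S.encard ≤ 2 := (encard_le_encard h).trans (encard_insert_le {b} a |>.trans (by simp [one_add_one_eq_two]))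
  exact absurd (h3.trans h2) (by decide)

theorem RootedSparseOn.sparseOn {𝓛 : Set (Set α)} {E : Set α} {P : α}
    (h : RootedSparseOn 𝓛 E P) : SparseOn 𝓛 E := by
  intro X hX hne
  by_cases hP : X ⊆ {P}
  · obtain ⟨x, hx⟩ := hne
    refine ⟨x, hx, fun L _ K _ _ _ h3 _ ↦ ?_⟩
    refine absurd h3 (not_three_le_encard_of_subset_pair (a := P) (b := P) ?_)
    simpa using inter_subset_right.trans hP
  · obtain ⟨x, hx, -, h1⟩ := h X hX hP
    exact ⟨x, hx, h1⟩

theorem subset_ground_of_mem_lines {M : Matroid α} {L : Set α} (hL : L ∈ lines M) : L ⊆ M.E :=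
  hL.prop.1.subset_ground

theorem IsUniformLine.eq_ground_of_mem_lines {M : Matroid α} (hM : IsUniformLine M) {L : Set α}
    (hL : L ∈ lines M) : L = M.E := by
  have hLE := subset_ground_of_mem_lines hL
  refine hL.eq_of_subset ⟨⟨?_, Subset.rfl⟩, fun T hT h3 ↦ ⟨?_, hT⟩⟩ hLE
  · intro h
    exact hL.prop.1.not_indep (h.subset hLE)
  · intro h
    rw [hM.2.2 T hT, h3] at h
    exact absurd h (by decide)

theorem IsUniformLine.rootedSparseOn {M : Matroid α} (hM : IsUniformLine M) (P : α) :
    RootedSparseOn (lines M) M.E P := by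
  intro X _ hXP
  obtain ⟨x, hx, hxP⟩ := not_subset.1 hXP
  exact ⟨x, hx, hxP, fun L hL K hK _ _ _ _ ↦
    (hM.eq_ground_of_mem_lines hL).trans (hM.eq_ground_of_mem_lines hK).symm⟩

/-- A point of `X` other than `P` and the nodes `p i` is on a single line. Without such a point, `X`
consists of nodes and possibly `P`. A line has only two nodes, so a line with three points of `X`
passes through `P`, which is then not a node and is on only one line. -/
theorem IsCycle.rootedSparseOn {M : Matroid α} (hM : IsCycle M) (P : α) :
    RootedSparseOn (lines M) M.E P := by
  obtain ⟨-, n, -, p, l, -, hl, hlines, hp, hone⟩ := hM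
  have eq_of_one : ∀ x ∈ M.E, x ∉ range p → ∀ L ∈ lines M, ∀ K ∈ lines M, x ∈ L → x ∈ K →
      L = K := by
    intro x hx hxp L hL K hK hxL hxK
    obtain ⟨J, hJ⟩ := encard_eq_one.1 (hone x hx hxp)
    have h1 : L ∈ linesThrough M x := ⟨hL, hxL⟩
    have h2 : K ∈ linesThrough M x := ⟨hK, hxK⟩
    rw [hJ] at h1 h2
    exact h1.trans h2.symm
  intro X hX hXP
  by_cases hcase : ∃ x ∈ X, x ≠ P ∧ x ∉ range p
  · obtain ⟨x, hx, hxP, hxp⟩ := hcase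
    exact ⟨x, hx, hxP, fun L hL K hK hxL hxK _ _ ↦
      eq_of_one x (hX hx) hxp L hL K hK hxL hxK⟩
  push Not at hcase
  have root_mem : ∀ L ∈ lines M, 3 ≤ (L ∩ X).encard → P ∈ L ∧ P ∈ X ∧ P ∉ range p := by
    intro L hL h3
    by_contra hP
    rw [← hlines] at hL
    obtain ⟨i, rfl⟩ := hL
    -- As `p j` is on `l j` and `l (j + 1)` only, the nodes on `l i` are `p i` and `p (i - 1)`.
    refine not_three_le_encard_of_subset_pair (a := p i) (b := p (i - 1)) ?_ h3
    rintro y ⟨hyl, hyX⟩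
    have hy : y ∈ range p := by
      by_contra hyp
      have hyP : y = P := by
        by_contra hne
        exact hyp (hcase y hyX hne)
      subst hyP
      exact hP ⟨hyl, hyX, hyp⟩
    obtain ⟨j, rfl⟩ := hy
    have hj : l i ∈ linesThrough M (p j) := ⟨hlines ▸ mem_range_self i, hyl⟩
    rw [(hp j).2] at hj
    rcases hj with hj | hj
    · exact Or.inl (congrArg p (hl hj).symm)
    · refine Or.inr (congrArg p ?_)
      rw [hl hj, add_sub_cancel_right]
  obtain ⟨x, hx, hxP⟩ := not_subset.1 hXP
  refine ⟨x, hx, hxP, fun L hL K hK _ _ h3 h3' ↦ ?_⟩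
  obtain ⟨hPL, hPX, hPp⟩ := root_mem L hL h3
  exact eq_of_one P (hX hPX) hPp L hL K hK hPL (root_mem K hK h3').1

/-- If `X` meets the new block outside `P`, the rooted property gives a point other than `P`, and
all lines of `M` through it belong to `N'`. Otherwise `X` lies in `N`, and lines of `N'` meet it at
most in `P`. -/
theorem IsFreeGluing.sparseOn {P : α} {N N' M : Matroid α} (h : IsFreeGluing P N N' M)
    (hN : SparseOn (lines N) N.E) (hN' : RootedSparseOn (lines N') N'.E P) :
    SparseOn (lines M) M.E := by
  intro X hX hne
  have inter_sub : ∀ y ∈ N.E, y ∈ N'.E → y = P := fun y h1 h2 ↦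
    h.inter_eq.subset ⟨h1, h2⟩
  rw [h.ground_eq] at hX
  by_cases hXN : X ∩ N'.E ⊆ {P}
  · have hP : P ∈ N.E := (h.inter_eq.superset rfl).1
    have hXE : X ⊆ N.E := fun y hy ↦ (hX hy).elim id fun hy' ↦ by
      rw [hXN ⟨hy, hy'⟩]
      exact hP
    obtain ⟨x, hx, h1⟩ := hN X hXE hne
    have mem_left : ∀ L ∈ lines M, 3 ≤ (L ∩ X).encard → L ∈ lines N := by
      intro L hL h3
      rw [h.lines_eq] at hL
      refine hL.resolve_right fun hL' ↦ ?_
      refine not_three_le_encard_of_subset_pair (a := P) (b := P) ?_ h3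
      rw [pair_eq_singleton]
      exact fun y hy ↦ hXN ⟨hy.2, subset_ground_of_mem_lines hL' hy.1⟩
    exact ⟨x, hx, fun L hL K hK hxL hxK h3 h3' ↦
      h1 L (mem_left L hL h3) K (mem_left K hK h3') hxL hxK h3 h3'⟩
  · obtain ⟨x, ⟨hx, hxN'⟩, hxP, h1⟩ := hN' _ inter_subset_right hXN
    have mem_right : ∀ L ∈ lines M, x ∈ L → L ∈ lines N' := by
      intro L hL hxL
      rw [h.lines_eq] at hL
      exact hL.resolve_left fun hL' ↦
        hxP (inter_sub x (subset_ground_of_mem_lines hL' hxL) hxN')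
    have inter_eq : ∀ L ∈ lines N', L ∩ (X ∩ N'.E) = L ∩ X := by
      intro L hL
      rw [inter_comm X, ← inter_assoc, inter_eq_left.2 (subset_ground_of_mem_lines hL)]
    refine ⟨x, hx, fun L hL K hK hxL hxK h3 h3' ↦ ?_⟩
    have hL' := mem_right L hL hxL
    have hK' := mem_right K hK hxK
    exact h1 L hL' K hK' hxL hxK (by rwa [inter_eq L hL']) (by rwa [inter_eq K hK'])

theorem IsConnectedCactus.sparseOn {M : Matroid α} (hM : IsConnectedCactus M) :
    SparseOn (lines M) M.E := by
  induction hM with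
  | line h => exact (h.rootedSparseOn h.2.1.some).sparseOn
  | cycle h =>
    obtain ⟨-, n, -, p, -⟩ := id h
    exact (h.rootedSparseOn (p 0)).sparseOn
  | @glue P _ _ _ _ hN' hglue ih =>
    exact hglue.sparseOn ih (hN'.elim (fun h ↦ h.rootedSparseOn P) fun h ↦ h.rootedSparseOn P)

/-! ### Connected components and their lines -/

theorem component_subset_ground (M : Matroid α) (x : α) : component M x ⊆ M.E :=
  fun _ hy ↦ hy.1

theorem subset_component_of_mem_lines {M : Matroid α} {x y : α} {L : Set α} (hL : L ∈ lines M)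
    (hy : y ∈ component M x) (hyL : y ∈ L) : L ⊆ component M x :=
  fun _ hz ↦ ⟨subset_ground_of_mem_lines hL hz, hy.2.tail ⟨L, hL, hyL, hz⟩⟩

theorem isCollinear_restrict_iff {M : Matroid α} {C L : Set α} (hC : C ⊆ M.E) :
    IsCollinear (M.restrict C) L ↔ IsCollinear M L ∧ L ⊆ C := by
  have dep_iff : ∀ T, (M.restrict C).Dep T ↔ M.Dep T ∧ T ⊆ C := fun T ↦ by
    rw [Matroid.restrict_dep_iff, Matroid.dep_iff]
    exact ⟨fun h ↦ ⟨⟨h.1, h.2.trans hC⟩, h.2⟩, fun h ↦ ⟨h.1.1, h.2⟩⟩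
  simp only [IsCollinear, dep_iff]
  exact ⟨fun h ↦ ⟨⟨h.1.1, fun T hT hT3 ↦ (h.2 T hT hT3).1⟩, h.1.2⟩,
    fun h ↦ ⟨⟨h.1.1, h.2⟩, fun T hT hT3 ↦ ⟨h.1.2 T hT hT3, hT.trans h.2⟩⟩⟩

theorem mem_lines_restrict {M : Matroid α} {C L : Set α} (hC : C ⊆ M.E) (hL : L ∈ lines M)
    (hLC : L ⊆ C) : L ∈ lines (M.restrict C) :=
  ⟨(isCollinear_restrict_iff hC).2 ⟨hL.prop, hLC⟩,
    fun _ hK hLK ↦ hL.2 ((isCollinear_restrict_iff hC).1 hK).1 hLK⟩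

theorem IsCactus.sparseOn {M : Matroid α} (hM : IsCactus M) : SparseOn (lines M) M.E := by
  rintro X hX ⟨y, hy⟩
  have hC := component_subset_ground M y
  obtain ⟨x, ⟨hx, hxC⟩, h1⟩ := (hM.2 y (hX hy)).sparseOn (X ∩ component M y) inter_subset_right
    ⟨y, hy, hX hy, Relation.ReflTransGen.refl⟩
  have inter_eq : ∀ L ⊆ component M y, L ∩ (X ∩ component M y) = L ∩ X := by
    intro L hL
    rw [inter_comm X, ← inter_assoc, inter_eq_left.2 hL]
  refine ⟨x, hx, fun L hL K hK hxL hxK h3 h3' ↦ ?_⟩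
  have hLC := subset_component_of_mem_lines hL hxC hxL
  have hKC := subset_component_of_mem_lines hK hxC hxK
  exact h1 L (mem_lines_restrict hC hL hLC) K (mem_lines_restrict hC hK hKC) hxL hxK
    (by rwa [inter_eq L hLC]) (by rwa [inter_eq K hKC])

/-- A dependent set of three points lies on a line. -/
theorem exists_line_of_dep {M : Matroid α} (hfin : M.E.Finite) {T : Set α} (hT : M.Dep T)
    (h3 : T.encard = 3) : ∃ L ∈ lines M, T ⊆ L := by
  have hcol : IsCollinear M T := by
    refine ⟨hT, fun T' hT' h3' ↦ ?_⟩
    have hTfin : T.Finite := hfin.subset hT.subset_ground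
    rwa [(hTfin.subset hT').eq_of_subset_of_encard_le hT' (h3.trans h3'.symm).le]
  have hfin' : {L | IsCollinear M L}.Finite :=
    hfin.finite_subsets.subset fun L hL ↦ hL.1.subset_ground
  obtain ⟨L, hTL, hL⟩ := hfin'.exists_le_maximal hcol
  exact ⟨L, hL, hTL⟩

end Sparse

/-! ### Irreducibility in terms of polynomials -/

section Irreducible

open MvPolynomial

variable {σ : Type*}

/-- A nonempty set on which the product of two polynomials vanishes only if one of them does. -/
def IsPolyIrreducible (R : Set (σ → ℂ)) : Prop :=
  R.Nonempty ∧ ∀ f g : MvPolynomial σ ℂ, (∃ y ∈ R, eval y f ≠ 0) → (∃ y ∈ R, eval y g ≠ 0) →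
    ∃ y ∈ R, eval y f ≠ 0 ∧ eval y g ≠ 0

/-- A union of nonvanishing loci of polynomials. -/
def IsPolyOpen (U : Set (σ → ℂ)) : Prop :=
  ∀ y ∈ U, ∃ f : MvPolynomial σ ℂ, eval y f ≠ 0 ∧ ∀ z, eval z f ≠ 0 → z ∈ U

theorem IsPolyOpen.of_isOpen {U : Set (σ → ℂ)} (hU : @IsOpen _ (zariskiTopology σ) U) :
    IsPolyOpen U := by
  obtain ⟨I, hI⟩ := hU
  intro y hy
  have hy' : y ∉ zeroLocus ℂ I := by
    rw [← hI]
    exact fun h ↦ h hy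
  simp only [mem_zeroLocus_iff, not_forall] at hy'
  obtain ⟨f, hf, hfy⟩ := hy'
  refine ⟨f, by simpa [aeval_eq_eval] using hfy, fun z hz ↦ ?_⟩
  by_contra hzU
  have hz' : z ∈ zeroLocus ℂ I := by
    rw [← hI]
    exact hzU
  exact hz (by simpa [aeval_eq_eval] using mem_zeroLocus_iff.1 hz' f hf)

theorem IsPolyIrreducible.isIrreducible {R : Set (σ → ℂ)} (hR : IsPolyIrreducible R) :
    @IsIrreducible _ (zariskiTopology σ) R := by
  refine ⟨hR.1, ?_⟩
  rintro U V hU hV ⟨y, hyR, hyU⟩ ⟨z, hzR, hzV⟩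
  obtain ⟨f, hf, hfU⟩ := IsPolyOpen.of_isOpen hU y hyU
  obtain ⟨g, hg, hgV⟩ := IsPolyOpen.of_isOpen hV z hzV
  obtain ⟨w, hw, hwf, hwg⟩ := hR.2 f g ⟨y, hyR, hf⟩ ⟨z, hzR, hg⟩
  exact ⟨w, hw, hfU w hwf, hgV w hwg⟩

/-- The polynomial ring is a domain, and over an infinite field a nonzero polynomial has a nonzero
value. -/
theorem isPolyIrreducible_univ : IsPolyIrreducible (univ : Set (σ → ℂ)) := by
  refine ⟨univ_nonempty, ?_⟩
  rintro f g ⟨y, -, hy⟩ ⟨z, -, hz⟩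
  have hf : f ≠ 0 := by
    rintro rfl
    simp at hy
  have hg : g ≠ 0 := by
    rintro rfl
    simp at hz
  by_contra! h
  refine mul_ne_zero hf hg (MvPolynomial.funext fun w ↦ ?_)
  by_cases hw : eval w f = 0
  · simp [hw]
  · simp [h w (mem_univ w) hw]

theorem IsPolyIrreducible.exists_forall_eval_ne_zero {R : Set (σ → ℂ)} (hR : IsPolyIrreducible R)
    {ι : Type*} (s : Finset ι) (f : ι → MvPolynomial σ ℂ)
    (hf : ∀ i ∈ s, ∃ y ∈ R, eval y (f i) ≠ 0) : ∃ y ∈ R, ∀ i ∈ s, eval y (f i) ≠ 0 := by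
  suffices h : ∃ y ∈ R, eval y (∏ i ∈ s, f i) ≠ 0 by
    obtain ⟨y, hy, h⟩ := h
    rw [map_prod, Finset.prod_ne_zero_iff] at h
    exact ⟨y, hy, h⟩
  induction s using Finset.cons_induction with
  | empty => exact ⟨hR.1.some, hR.1.some_mem, by simp⟩
  | cons i s hi ih =>
    obtain ⟨y, hy, h1, h2⟩ := hR.2 _ _ (hf i (Finset.mem_cons_self i s))
      (ih fun j hj ↦ hf j (Finset.mem_cons_of_mem hj))
    exact ⟨y, hy, by rw [Finset.prod_cons, map_mul]; exact mul_ne_zero h1 h2⟩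

theorem eval_bind₁ {τ : Type*} (Φ : τ → MvPolynomial σ ℂ) (f : MvPolynomial τ ℂ) (y : σ → ℂ) :
    eval y (bind₁ Φ f) = eval (fun p ↦ eval y (Φ p)) f :=
  eval₂Hom_bind₁ (RingHom.id ℂ) y Φ f

/-- The intersection of the image of an irreducible set under a polynomial map with finitely many
open sets meeting it is irreducible. -/
theorem IsPolyIrreducible.image_inter {τ ι : Type*} [Finite ι] {R : Set (σ → ℂ)}
    (hR : IsPolyIrreducible R) (Φ : τ → MvPolynomial σ ℂ) (U : ι → Set (τ → ℂ))
    (hU : ∀ i, IsPolyOpen (U i)) (hne : ∀ i, ∃ y ∈ R, (fun p ↦ eval y (Φ p)) ∈ U i) :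
    IsPolyIrreducible {z | (∃ y ∈ R, (fun p ↦ eval y (Φ p)) = z) ∧ ∀ i, z ∈ U i} := by
  cases nonempty_fintype ι
  choose y hyR hyU using hne
  choose f hf hfU using fun i ↦ hU i _ (hyU i)
  have key : ∀ g h : MvPolynomial τ ℂ, (∃ y ∈ R, eval (fun p ↦ eval y (Φ p)) g ≠ 0) →
      (∃ y ∈ R, eval (fun p ↦ eval y (Φ p)) h ≠ 0) →
      ∃ y ∈ R, (∀ i, (fun p ↦ eval y (Φ p)) ∈ U i) ∧ eval (fun p ↦ eval y (Φ p)) g ≠ 0 ∧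
        eval (fun p ↦ eval y (Φ p)) h ≠ 0 := by
    intro g h hg hh
    simp only [← eval_bind₁] at hg hh
    -- The open conditions are pulled back to the source and merged into one polynomial that is not
    -- identically zero on `R`.
    have hall : ∃ w ∈ R, eval w (∏ i, bind₁ Φ (f i)) ≠ 0 := by
      obtain ⟨w, hw, hwf⟩ := hR.exists_forall_eval_ne_zero Finset.univ (fun i ↦ bind₁ Φ (f i))
        fun i _ ↦ ⟨y i, hyR i, by rw [eval_bind₁]; exact hf i⟩
      exact ⟨w, hw, by rw [map_prod]; exact Finset.prod_ne_zero_iff.2 hwf⟩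
    obtain ⟨v, hv, hvg, hvh⟩ := hR.2 _ _ hg hh
    obtain ⟨w, hw, h1, h2⟩ := hR.2 _ (bind₁ Φ g * bind₁ Φ h) hall
      ⟨v, hv, by rw [map_mul]; exact mul_ne_zero hvg hvh⟩
    rw [map_prod, Finset.prod_ne_zero_iff] at h1
    rw [map_mul, mul_ne_zero_iff, eval_bind₁, eval_bind₁] at h2
    refine ⟨w, hw, fun i ↦ hfU i _ ?_, h2⟩
    rw [← eval_bind₁]
    exact h1 i (Finset.mem_univ i)
  constructor
  · obtain ⟨w, hw⟩ := hR.1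
    obtain ⟨v, hv, hvU, -⟩ := key 1 1 ⟨w, hw, by simp⟩ ⟨w, hw, by simp⟩
    exact ⟨_, ⟨v, hv, rfl⟩, hvU⟩
  · rintro g h ⟨_, ⟨⟨w, hw, rfl⟩, -⟩, hwg⟩ ⟨_, ⟨⟨v, hv, rfl⟩, -⟩, hvh⟩
    obtain ⟨u, hu, huU, h1, h2⟩ := key g h ⟨w, hw, hwg⟩ ⟨v, hv, hvh⟩
    exact ⟨_, ⟨⟨u, hu, rfl⟩, huU⟩, h1, h2⟩

end Irreducible

/-! ### Realizations of a subset of the points -/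

section Realizations

open MvPolynomial

variable {d : ℕ}

/-- The vector in `ℂ³` attached to a point. -/
abbrev vec (γ : Fin d × Fin 3 → ℂ) (i : Fin d) : Fin 3 → ℂ := fun j ↦ γ (i, j)

/-- A left inverse `g` of the linear combination map at `γ` turns the vectors into a square matrix.
Its determinant is polynomial in the configuration, equals `1` at `γ`, and forces independence
wherever it is nonzero. -/
theorem isPolyOpen_linearIndepOn (S : Set (Fin d)) :
    IsPolyOpen {γ : Fin d × Fin 3 → ℂ | LinearIndepOn ℂ (vec γ) S} := by
  classical
  intro γ hγ
  obtain ⟨g, hg⟩ := LinearMap.exists_leftInverse_of_injective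
    (Finsupp.linearCombination ℂ fun s : S ↦ vec γ s) (LinearMap.ker_eq_bot.2 hγ)
  let A : Matrix S S (MvPolynomial (Fin d × Fin 3) ℂ) :=
    Matrix.of fun s t ↦ ∑ j, X (s.1, j) * C (g (Pi.single j 1) t)
  have hA : ∀ δ : Fin d × Fin 3 → ℂ,
      eval δ A.det = (Matrix.of fun s t : S ↦ g (vec δ s) t).det := by
    intro δ
    rw [RingHom.map_det]
    congr 1
    ext s t
    have hs : vec δ s = ∑ j, δ (s.1, j) • Pi.single (M := fun _ ↦ ℂ) j 1 :=
      pi_eq_sum_univ' (vec δ s)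
    simp only [A, RingHom.mapMatrix_apply, Matrix.map_apply, Matrix.of_apply, map_sum, map_mul,
      eval_X, eval_C]
    rw [hs]
    simp [Finsupp.finsetSum_apply]
  refine ⟨A.det, ?_, fun δ hδ ↦ ?_⟩
  · have h1 : (Matrix.of fun s t : S ↦ g (vec γ s) t) = 1 := by
      ext s t
      have hs := LinearMap.congr_fun hg (Finsupp.single s 1)
      simp only [LinearMap.comp_apply, Finsupp.linearCombination_single, one_smul,
        LinearMap.id_apply] at hs
      rw [Matrix.of_apply, hs, Finsupp.single_apply, Matrix.one_apply]
    rw [hA, h1, Matrix.det_one]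
    exact one_ne_zero
  · rw [hA] at hδ
    have hrows := Matrix.linearIndependent_rows_of_det_ne_zero hδ
    exact LinearIndependent.of_comp (Finsupp.lcoeFun.comp g) hrows

/-- The vector configurations that realize the restriction of `M` to `X`; the vectors of the
points outside of `X` are arbitrary. -/
def partialRealizations (M : Matroid (Fin d)) (X : Set (Fin d)) : Set (Fin d × Fin 3 → ℂ) :=
  {γ | ∀ S ⊆ X, (M.Dep S ↔ ¬ LinearIndepOn ℂ (vec γ) S)}

theorem linearIndepOn_of_mem_partialRealizations {M : Matroid (Fin d)} {X S : Set (Fin d)}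
    {γ : Fin d × Fin 3 → ℂ} (hγ : γ ∈ partialRealizations M X) (hS : S ⊆ X) (hi : M.Indep S) :
    LinearIndepOn ℂ (vec γ) S := by
  by_contra h
  exact ((hγ S hS).2 h).not_indep hi

theorem mem_partialRealizations_congr {M : Matroid (Fin d)} {X : Set (Fin d)}
    {γ δ : Fin d × Fin 3 → ℂ} (h : ∀ i ∈ X, vec γ i = vec δ i)
    (hγ : γ ∈ partialRealizations M X) : δ ∈ partialRealizations M X := by
  intro S hS
  rw [hγ S hS, linearIndepOn_congr fun i hi ↦ h i (hS hi)]

theorem encard_le_three_of_linearIndepOn {γ : Fin d × Fin 3 → ℂ} {S : Set (Fin d)}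
    (h : LinearIndepOn ℂ (vec γ) S) : S.encard ≤ 3 := by
  have h1 := h.encard_le_toENat_rank
  simpa using h1

/-- The configuration `γ` with the vector of `x` replaced by `w`. -/
def setVec (γ : Fin d × Fin 3 → ℂ) (x : Fin d) (w : Fin 3 → ℂ) : Fin d × Fin 3 → ℂ :=
  fun p ↦ if p.1 = x then w p.2 else γ p

theorem vec_setVec_self (γ : Fin d × Fin 3 → ℂ) (x : Fin d) (w : Fin 3 → ℂ) :
    vec (setVec γ x w) x = w := by
  ext j
  simp [vec, setVec]

theorem vec_setVec_of_ne (γ : Fin d × Fin 3 → ℂ) {x i : Fin d} (w : Fin 3 → ℂ) (h : i ≠ x) :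
    vec (setVec γ x w) i = vec γ i := by
  ext j
  simp [vec, setVec, h]

theorem setVec_mem_partialRealizations {M : Matroid (Fin d)} {X : Set (Fin d)}
    {γ : Fin d × Fin 3 → ℂ} {x : Fin d} (hx : x ∉ X) (w : Fin 3 → ℂ)
    (hγ : γ ∈ partialRealizations M X) : setVec γ x w ∈ partialRealizations M X :=
  mem_partialRealizations_congr
    (fun _ hi ↦ (vec_setVec_of_ne γ w (ne_of_mem_of_not_mem hi hx)).symm) hγ

/-- A criterion for the irreducibility of the realizations to pass from `X` to `insert x X`, in
terms of a polynomial map that changes only the vector of `x`. -/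
theorem isPolyIrreducible_insert_of_map {M : Matroid (Fin d)} (hE : M.E = univ)
    {X : Set (Fin d)} {x : Fin d} (hX : IsPolyIrreducible (partialRealizations M X))
    (Φ : Fin d × Fin 3 → MvPolynomial (Fin d × Fin 3) ℂ) (φ : (Fin d × Fin 3 → ℂ) → _)
    (hφ : φ = fun γ p ↦ eval γ (Φ p))
    (hfix : ∀ γ, ∀ i ≠ x, vec (φ γ) i = vec γ i)
    (hsurj : ∀ γ ∈ partialRealizations M (insert x X), ∃ y ∈ partialRealizations M X, φ y = γ)
    (hdep : ∀ y ∈ partialRealizations M X, ∀ S ⊆ X, x ∉ S → M.Indep S → M.Dep (insert x S) →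
      ¬ LinearIndepOn ℂ (vec (φ y)) (insert x S))
    (hindep : ∀ S ⊆ X, x ∉ S → M.Indep (insert x S) →
      ∃ y ∈ partialRealizations M X, LinearIndepOn ℂ (vec (φ y)) (insert x S)) :
    IsPolyIrreducible (partialRealizations M (insert x X)) := by
  have hcongr : ∀ y, ∀ S, x ∉ S →
      (LinearIndepOn ℂ (vec (φ y)) S ↔ LinearIndepOn ℂ (vec y) S) := fun y S hS ↦
    linearIndepOn_congr fun i hi ↦ hfix y i (ne_of_mem_of_not_mem hi hS)
  have hS' : ∀ S ⊆ insert x X, S \ {x} ⊆ X := fun S hS ↦ by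
    rwa [sdiff_singleton_subset_iff]
  have himage := hX.image_inter Φ
    (fun S : {S // S ⊆ insert x X ∧ M.Indep S} ↦ {γ | LinearIndepOn ℂ (vec γ) S.1})
    (fun S ↦ isPolyOpen_linearIndepOn S.1) (by
      rintro ⟨S, hS, hi⟩
      suffices h : ∃ y ∈ partialRealizations M X, LinearIndepOn ℂ (vec (φ y)) S by
        simpa only [hφ, mem_ofPred_eq] using h
      by_cases hxS : x ∈ S
      · have := hindep (S \ {x}) (hS' S hS) (by simp) (by rwa [insert_sdiff_self_of_mem hxS])
        rwa [insert_sdiff_self_of_mem hxS] at this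
      · obtain ⟨y, hy⟩ := hX.1
        exact ⟨y, hy, (hcongr y S hxS).2 (linearIndepOn_of_mem_partialRealizations hy
          ((subset_insert_iff_of_notMem hxS).1 hS) hi)⟩)
  convert himage using 1
  ext γ
  constructor
  · intro hγ
    obtain ⟨y, hy, hyγ⟩ := hsurj γ hγ
    exact ⟨⟨y, hy, by rw [← hyγ, hφ]⟩,
      fun S ↦ linearIndepOn_of_mem_partialRealizations hγ S.2.1 S.2.2⟩
  · rintro ⟨⟨y, hy, rfl⟩, hU⟩ S hS
    have hφy : (fun p ↦ eval y (Φ p)) = φ y := by rw [hφ]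
    rw [hφy] at hU ⊢
    constructor
    · intro hd
      by_cases hxS : x ∈ S
      · by_cases hi : M.Indep (S \ {x})
        · have := hdep y hy (S \ {x}) (hS' S hS) (by simp) hi
            (by rwa [insert_sdiff_self_of_mem hxS])
          rwa [insert_sdiff_self_of_mem hxS] at this
        · intro hli
          refine (hy _ (hS' S hS)).1 ((Matroid.not_indep_iff (hE ▸ subset_univ _)).1 hi) ?_
          exact (hcongr y _ (by simp)).1 (hli.mono sdiff_subset)
      · rw [hcongr y S hxS]
        exact (hy S ((subset_insert_iff_of_notMem hxS).1 hS)).1 hd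
    · intro hli
      by_contra hd
      exact hli (hU ⟨S, hS, (Matroid.not_dep_iff (hE ▸ subset_univ _)).1 hd⟩)

/-! ### Extending the realizations by one point -/

theorem IsConfiguration.encard_le_three {M : Matroid (Fin d)} (hM : IsConfiguration M)
    {S : Set (Fin d)} (hS : M.Indep S) : S.encard ≤ 3 :=
  hS.encard_le_eRank.trans hM.rank_le

/-- Simplicity excludes fewer than two elements. Of the remaining cases, three elements impose
nothing, as four vectors of `ℂ³` are always dependent, so only collinear triples constrain a new
point. -/
theorem IsConfiguration.encard_eq_of_dep_insert {M : Matroid (Fin d)} (hM : IsConfiguration M)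
    {S : Set (Fin d)} {x : Fin d} (hS : M.Indep S) (hd : M.Dep (insert x S)) :
    S.encard = 3 ∨ ∃ u v, u ≠ v ∧ S = {u, v} := by
  have hxE : x ∈ M.E := hd.subset_ground (mem_insert x S)
  have h3 := hM.encard_le_three hS
  have hfin : S.Finite := S.toFinite
  rw [← hfin.cast_ncard_eq] at h3 ⊢
  norm_cast at h3 ⊢
  interval_cases h : S.ncard
  · rw [ncard_eq_zero] at h
    subst h
    exact absurd (by simpa using hM.simple x hxE x hxE) hd.not_indep
  · obtain ⟨u, rfl⟩ := ncard_eq_one.1 h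
    exact absurd (hM.simple x hxE u (hS.subset_ground rfl)) hd.not_indep
  · obtain ⟨u, v, huv, rfl⟩ := ncard_eq_two.1 h
    exact Or.inr ⟨u, v, huv, rfl⟩
  · exact Or.inl rfl

theorem not_linearIndepOn_insert_of_encard_eq_three {γ : Fin d × Fin 3 → ℂ} {S : Set (Fin d)}
    {x : Fin d} (hx : x ∉ S) (hS : S.encard = 3) : ¬ LinearIndepOn ℂ (vec γ) (insert x S) := by
  intro h
  have h1 := encard_le_three_of_linearIndepOn h
  rw [encard_insert_of_notMem hx, hS] at h1
  exact absurd h1 (by decide)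

/-- Adding a point that lies on no line. -/
theorem isPolyIrreducible_insert_of_free {M : Matroid (Fin d)} (hM : IsConfiguration M)
    (hE : M.E = univ) {X : Set (Fin d)} {x : Fin d} (hx : x ∉ X)
    (hfree : ∀ u ∈ X, ∀ v ∈ X, u ≠ v → ¬ M.Dep {x, u, v})
    (hX : IsPolyIrreducible (partialRealizations M X)) :
    IsPolyIrreducible (partialRealizations M (insert x X)) := by
  refine isPolyIrreducible_insert_of_map hE hX MvPolynomial.X id (by ext; simp)
    (fun _ _ _ ↦ rfl) (fun γ hγ ↦ ⟨γ, fun S hS ↦ hγ S (hS.trans (subset_insert x X)), rfl⟩) ?_ ?_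
  · intro y _ S hS hxS hi hd
    obtain h3 | ⟨u, v, huv, rfl⟩ := hM.encard_eq_of_dep_insert hi hd
    · exact not_linearIndepOn_insert_of_encard_eq_three hxS h3
    · exact absurd hd (hfree u (hS (by simp)) v (hS (by simp)) huv)
  · intro S hS hxS hi
    obtain ⟨y, hy⟩ := hX.1
    -- `insert x S` is independent, so `S` has at most two elements and cannot span `ℂ³`.
    have hspan : Submodule.span ℂ (vec y '' S) ≠ ⊤ := by
      intro htop
      have h1 := hM.encard_le_three hi
      rw [encard_insert_of_notMem hxS, ← S.toFinite.cast_ncard_eq] at h1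
      norm_cast at h1
      have := Fintype.ofFinite (vec y '' S)
      have h2 := finrank_span_le_card (R := ℂ) (vec y '' S)
      rw [htop, finrank_top, Module.finrank_fin_fun, ← ncard_eq_toFinset_card'] at h2
      have h3 := ncard_image_le (f := vec y) S.toFinite
      omega
    obtain ⟨w, hw⟩ : ∃ w, w ∉ Submodule.span ℂ (vec y '' S) := by
      by_contra! h
      exact hspan (Submodule.eq_top_iff'.2 h)
    refine ⟨_, setVec_mem_partialRealizations hx w hy, ?_⟩
    have heq : EqOn (vec (setVec y x w)) (vec y) S := fun i hi ↦
      vec_setVec_of_ne y w (ne_of_mem_of_not_mem hi hxS)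
    rw [id, linearIndepOn_insert hxS, linearIndepOn_congr heq, heq.image_eq, vec_setVec_self]
    exact ⟨linearIndepOn_of_mem_partialRealizations hy hS (hi.subset (subset_insert x S)), hw⟩

theorem mem_span_pair_of_dep {M : Matroid (Fin d)} {X : Set (Fin d)} {γ : Fin d × Fin 3 → ℂ}
    (hγ : γ ∈ partialRealizations M X) {a b c : Fin d} (ha : a ∈ X) (hb : b ∈ X) (hc : c ∈ X)
    (hab : M.Indep {a, b}) (hd : M.Dep {c, a, b}) :
    vec γ c ∈ Submodule.span ℂ {vec γ a, vec γ b} := by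
  have hcab : c ∉ ({a, b} : Set (Fin d)) := fun h ↦
    hd.not_indep (by rwa [insert_eq_of_mem h])
  have h1 := (hγ {c, a, b} (by simp [insert_subset_iff, ha, hb, hc])).1 hd
  rw [linearIndepOn_insert hcab, image_pair] at h1
  by_contra h2
  exact h1 ⟨linearIndepOn_of_mem_partialRealizations hγ (by simp [insert_subset_iff, ha, hb]) hab,
    h2⟩

theorem not_linearIndepOn_triple_of_mem_span_pair {γ : Fin d × Fin 3 → ℂ} {S : Set (Fin d)}
    {p q : Fin 3 → ℂ} (hS : S.encard = 3) (h : ∀ i ∈ S, vec γ i ∈ Submodule.span ℂ {p, q}) :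
    ¬ LinearIndepOn ℂ (vec γ) S := by
  classical
  intro hli
  have h1 := linearIndependent_le_span' (fun i : S ↦ vec γ i) hli {p, q} (by
    rintro _ ⟨i, rfl⟩
    exact h i i.2)
  have h2 : Fintype.card ({p, q} : Set (Fin 3 → ℂ)) ≤ 2 := by
    rw [← Nat.card_eq_fintype_card, Nat.card_coe_set_eq]
    exact (ncard_insert_le p {q}).trans (by simp)
  have h3 : S.ncard = 3 := by
    rw [ncard, hS]
    rfl
  rw [← cast_ncard S.toFinite, h3] at h1
  norm_cast at h1
  omega

/-- Adding a point that lies on exactly one line. -/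
theorem isPolyIrreducible_insert_of_line {M : Matroid (Fin d)} (hM : IsConfiguration M)
    (hE : M.E = univ) {X : Set (Fin d)} {x a b : Fin d} (hx : x ∉ X) (ha : a ∈ X) (hb : b ∈ X)
    {L : Set (Fin d)} (hL : IsCollinear M L) (hab : a ≠ b) (haL : a ∈ L) (hbL : b ∈ L)
    (hxL : x ∈ L) (hline : ∀ u ∈ X, ∀ v ∈ X, u ≠ v → M.Dep {x, u, v} → u ∈ L ∧ v ∈ L)
    (hX : IsPolyIrreducible (partialRealizations M X)) :
    IsPolyIrreducible (partialRealizations M (insert x X)) := by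
  have hmemE : ∀ i, i ∈ M.E := fun i ↦ hE ▸ mem_univ i
  have hiab : M.Indep {a, b} := hM.simple a (hmemE a) b (hmemE b)
  have hxa : x ≠ a := (ne_of_mem_of_not_mem ha hx).symm
  have hxb : x ≠ b := (ne_of_mem_of_not_mem hb hx).symm
  have hdep : ∀ c ∈ L, c ≠ a → c ≠ b → M.Dep {c, a, b} := fun c hc hca hcb ↦
    hL.2 _ (by simp [insert_subset_iff, hc, haL, hbL])
      (encard_eq_three.2 ⟨c, a, b, hca, hcb, hab, rfl⟩)
  let Φ : Fin d × Fin 3 → MvPolynomial (Fin d × Fin 3) ℂ := fun p ↦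
    if p.1 = x then MvPolynomial.X (x, 0) * MvPolynomial.X (a, p.2) +
      MvPolynomial.X (x, 1) * MvPolynomial.X (b, p.2) else MvPolynomial.X p
  let φ : (Fin d × Fin 3 → ℂ) → (Fin d × Fin 3 → ℂ) := fun γ p ↦ eval γ (Φ p)
  have hφx : ∀ γ, vec (φ γ) x = vec γ x 0 • vec γ a + vec γ x 1 • vec γ b := by
    intro γ
    ext j
    simp [φ, Φ, vec]
  have hφi : ∀ γ, ∀ i ≠ x, vec (φ γ) i = vec γ i := by
    intro γ i hi
    ext j
    simp [φ, Φ, vec, hi]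
  have hφset : ∀ γ w, vec (φ (setVec γ x w)) x = w 0 • vec γ a + w 1 • vec γ b := by
    intro γ w
    rw [hφx, vec_setVec_self, vec_setVec_of_ne _ _ hxa.symm, vec_setVec_of_ne _ _ hxb.symm]
  refine isPolyIrreducible_insert_of_map hE hX Φ φ rfl hφi ?_ ?_ ?_
  -- The coefficients of the vector of `x` are stored as its first two coordinates; the third does
  -- not enter `φ`.
  · intro γ hγ
    obtain ⟨s, t, hst⟩ := Submodule.mem_span_pair.1 <|
      mem_span_pair_of_dep hγ (mem_insert_of_mem x ha) (mem_insert_of_mem x hb)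
        (mem_insert x X) hiab (hdep x hxL hxa hxb)
    refine ⟨setVec γ x ![s, t, 0], setVec_mem_partialRealizations hx _
      fun S hS ↦ hγ S (hS.trans (subset_insert x X)), ?_⟩
    suffices h : ∀ i, vec (φ (setVec γ x ![s, t, 0])) i = vec γ i by
      ext ⟨i, j⟩
      exact congrFun (h i) j
    intro i
    by_cases hi : i = x
    · subst hi
      simpa [hφset] using hst
    · rw [hφi _ i hi, vec_setVec_of_ne _ _ hi]
  · intro y hy S hS hxS hi hd
    obtain h3 | ⟨u, v, huv, rfl⟩ := hM.encard_eq_of_dep_insert hi hd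
    · exact not_linearIndepOn_insert_of_encard_eq_three hxS h3
    have huX : u ∈ X := hS (by simp)
    have hvX : v ∈ X := hS (by simp)
    obtain ⟨huL, hvL⟩ := hline u huX v hvX huv hd
    -- All vectors of `L` lie in the plane of `a` and `b`, so any three of them are dependent.
    have hspan : ∀ c ∈ X, c ∈ L → vec (φ y) c ∈ Submodule.span ℂ {vec y a, vec y b} := by
      intro c hc hcL
      rw [hφi y c (ne_of_mem_of_not_mem hc hx)]
      by_cases hca : c = a
      · exact Submodule.subset_span (by simp [hca])
      by_cases hcb : c = b
      · exact Submodule.subset_span (by simp [hcb])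
      exact mem_span_pair_of_dep hy ha hb hc hiab (hdep c hcL hca hcb)
    refine not_linearIndepOn_triple_of_mem_span_pair (p := vec y a) (q := vec y b) ?_ ?_
    · rw [encard_insert_of_notMem hxS, encard_pair huv]
      rfl
    · rintro i (rfl | rfl | rfl)
      · rw [hφx]
        exact Submodule.mem_span_pair.2 ⟨_, _, rfl⟩
      · exact hspan _ huX huL
      · exact hspan _ hvX hvL
  · intro S hS hxS hi
    have hiS : M.Indep S := hi.subset (subset_insert x S)
    obtain ⟨y, hy⟩ := hX.1
    -- Since `x` is in the closure of `{a, b}` but not of `S`, one of `a` and `b` is outside the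
    -- closure of `S`. Giving `x` the vector of that point makes `insert x S` independent.
    obtain ⟨c, w, hcX, hc, hw⟩ : ∃ (c : Fin d) (w : Fin 3 → ℂ), c ∈ X ∧ c ∉ M.closure S ∧
        w 0 • vec y a + w 1 • vec y b = vec y c := by
      by_cases hacl : a ∈ M.closure S
      · refine ⟨b, ![0, 1, 0], hb, fun hbcl ↦ ?_, by simp⟩
        have hxcl : x ∈ M.closure {a, b} :=
          hiab.mem_closure_iff.2 (Or.inl (hdep x hxL hxa hxb))
        have hxS' : x ∈ M.closure S :=
          M.closure_subset_closure_of_subset_closure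
            (by simp [insert_subset_iff, hacl, hbcl]) hxcl
        exact (hiS.notMem_closure_iff_of_notMem hxS).2 hi hxS'
      · exact ⟨a, ![1, 0, 0], ha, hacl, by simp⟩
    have hcS : c ∉ S := fun h ↦ hc (M.mem_closure_of_mem h hiS.subset_ground)
    have hli := linearIndepOn_of_mem_partialRealizations hy (insert_subset hcX hS)
      ((hiS.notMem_closure_iff_of_notMem hcS).1 hc)
    refine ⟨_, setVec_mem_partialRealizations hx w hy, ?_⟩
    have heq : EqOn (vec (φ (setVec y x w))) (vec y) S := fun i hi ↦ by
      have hix := ne_of_mem_of_not_mem hi hxS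
      rw [hφi _ i hix, vec_setVec_of_ne _ _ hix]
    rwa [linearIndepOn_insert hxS, linearIndepOn_congr heq, heq.image_eq, hφset, hw,
      ← linearIndepOn_insert hcS]

/-- Adding a point that lies on at most one line. -/
theorem isPolyIrreducible_insert {M : Matroid (Fin d)} (hM : IsConfiguration M)
    (hE : M.E = univ) {X : Set (Fin d)} {x : Fin d} (hx : x ∉ X)
    (hone : AtMostOneLine (lines M) (insert x X) x)
    (hX : IsPolyIrreducible (partialRealizations M X)) :
    IsPolyIrreducible (partialRealizations M (insert x X)) := by
  have hline : ∀ u ∈ X, ∀ v ∈ X, u ≠ v → M.Dep {x, u, v} →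
      ∃ L ∈ lines M, {x, u, v} ⊆ L ∧ 3 ≤ (L ∩ insert x X).encard := by
    intro u hu v hv huv hd
    have h3 : ({x, u, v} : Set (Fin d)).encard = 3 := encard_eq_three.2
      ⟨x, u, v, (ne_of_mem_of_not_mem hu hx).symm, (ne_of_mem_of_not_mem hv hx).symm, huv, rfl⟩
    obtain ⟨L, hL, hsub⟩ := exists_line_of_dep hM.finite hd h3
    exact ⟨L, hL, hsub, h3.symm.le.trans (encard_le_encard
      (subset_inter hsub (by simp [insert_subset_iff, hu, hv])))⟩
  by_cases hfree : ∀ u ∈ X, ∀ v ∈ X, u ≠ v → ¬ M.Dep {x, u, v}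
  · exact isPolyIrreducible_insert_of_free hM hE hx hfree hX
  push Not at hfree
  obtain ⟨a, ha, b, hb, hab, hd⟩ := hfree
  obtain ⟨L, hL, hsub, h3⟩ := hline a ha b hb hab hd
  refine isPolyIrreducible_insert_of_line hM hE hx ha hb hL.prop hab (hsub (by simp))
    (hsub (by simp)) (hsub (by simp)) (fun u hu v hv huv hd' ↦ ?_) hX
  obtain ⟨K, hK, hsub', h3'⟩ := hline u hu v hv huv hd'
  -- Every dependent triple through `x` spans a line with three points of `insert x X`, hence the
  -- same line `L`.
  obtain rfl := hone K hK L hL (hsub' (by simp)) (hsub (by simp)) h3' h3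
  exact ⟨hsub' (by simp), hsub' (by simp)⟩

theorem partialRealizations_empty (M : Matroid (Fin d)) : partialRealizations M ∅ = univ := by
  refine eq_univ_of_forall fun γ S hS ↦ ?_
  obtain rfl := subset_empty_iff.1 hS
  simp [M.empty_indep.not_dep, linearIndepOn_empty]

theorem isPolyIrreducible_partialRealizations {M : Matroid (Fin d)} (hM : IsConfiguration M)
    (hE : M.E = univ) (hsparse : SparseOn (lines M) M.E) (X : Set (Fin d)) :
    IsPolyIrreducible (partialRealizations M X) := by
  induction hn : X.ncard generalizing X with
  | zero =>
    rw [(ncard_eq_zero).1 hn, partialRealizations_empty]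
    exact isPolyIrreducible_univ
  | succ n ih =>
    have hne : X.Nonempty := nonempty_of_ncard_ne_zero (by omega)
    obtain ⟨x, hxX, hone⟩ := hsparse X (hE ▸ subset_univ X) hne
    rw [← insert_sdiff_self_of_mem hxX] at hone ⊢
    refine isPolyIrreducible_insert hM hE (by simp) hone (ih _ ?_)
    rw [ncard_sdiff_singleton_of_mem hxX, hn, Nat.add_sub_cancel]

end Realizations

end PointLine

theorem mainTheorem4 (d : ℕ) (M : Matroid (Fin d)) (hE : M.E = Set.univ)
    (hM : PointLine.IsCactus M) :
    (PointLine.realizationSpace M).Nonempty ∧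
      @IsIrreducible _ (PointLine.zariskiTopology (Fin d × Fin 3))
        (PointLine.matroidVariety M) := by
  -- `realizationSpace M` is by definition `partialRealizations M M.E`.
  have h : PointLine.IsPolyIrreducible (PointLine.realizationSpace M) :=
    PointLine.isPolyIrreducible_partialRealizations hM.1 hE hM.sparseOn M.E
  exact ⟨h.1, (@isIrreducible_iff_closure _ (PointLine.zariskiTopology (Fin d × Fin 3)) _).2
    h.isIrreducible⟩
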